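/- Let $F$ be an algebraically closed field of characteristic $5$. Let $\mathcal O=\mathcal O(2;(1,1))$ be the divided power algebra over $F$ with basis $x_1^{(a)}x_2^{(b)}$ $(0\le a,b\le 4)$, product $x_1^{(a)}x_2^{(b)}\cdot x_1^{(c)}x_2^{(d)}=\binom{a+c}{a}\binom{b+d}{b}x_1^{(a+c)}x_2^{(b+d)}$ (read as $0$ if $a+c>4$ or $b+d>4$), and derivations $\partial_1,\partial_2$ given by $\partial_1(x_1^{(a)}x_2^{(b)})=x_1^{(a-1)}x_2^{(b)}$, $\partial_2(x_1^{(a)}x_2^{(b)})=x_1^{(a)}x_2^{(b-1)}$ (with $x_i^{(-1)}=0$). Let $W=\mathcal O\partial_1\oplus\mathcal O\partial_2$ with the commutator bracket of derivations, let $\mathrm{div}(u_1\partial_1+u_2\partial_2)=\partial_1(u_1)+\partial_2(u_2)$, and let $\widetilde W=\{\widetilde E: E\in W\}$ be a second copy of the vector space $W$. The restricted Melikian algebra is the $125$-dimensional Lie algebra $\mathcal M=\mathcal M(1,1)=\mathcal O\oplus W\oplus\widetilde W$ whose (anticommutative) bracket extends that of $W$ and satisfies, for $D,E\in W$ and $f,g,u_i,v_i\in\mathcal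 O$, $$[D,\widetilde E]=\widetilde{[D,E]}+2\,\mathrm{div}(D)\widetilde E,\qquad [D,f]=D(f)-2\,\mathrm{div}(D)f,\qquad [f,\widetilde E]=fE,$$ $$[f,g]=2\,(f\widetilde{D_g}-g\widetilde{D_f}),\quad D_f=\partial_1(f)\partial_2-\partial_2(f)\partial_1,\qquad [\widetilde{u_1\partial_1+u_2\partial_2},\widetilde{v_1\partial_1+v_2\partial_2}]=u_1v_2-u_2v_1 .$$ Then $\mathcal M$ has no nontrivial central extensions. Precisely: 1. $H^2(\mathcal M,F)=0$, where $F$ is the trivial $\mathcal M$-module. 2. Every central extension of $\mathcal M$ splits: if $p:E\to\mathcal M$ is a surjective homomorphism of Lie algebras over $F$ whose kernel lies in the center of $E$, then there is a Lie algebra homomorphism $s:\mathcal M\to E$ with $p\circ s=\mathrm{id}_{\mathcal M}$. 3. If $\widetilde{\mathcal M}$ is a Lie algebra over $F$ with center $\mathfrak z$ and $\widetilde{\mathcal M}/\mathfrak z\cong\mathcal M$, then $\widetilde{\mathcal M}^{(1)}=[\widetilde{\mathcal M},\widetilde{\mathcal M}]\cong\mathcal M$ and $\widetilde{\mathcal M}=\widetilde{\mathcal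 M}^{(1)}\oplus\mathfrak z$. -/

import Mathlib

/-! ## The truncated divided power algebra in two variables over a ring of characteristic `5` -/

/-- The divided power algebra `𝒪(2; (1,1))` over `F`, in characteristic `5`. It has the basis
`x₁^(a) x₂^(b)` with `0 ≤ a, b ≤ 4`; an element is the family of its coefficients, so that
`f : DivPow F` stands for `∑ f (a, b) x₁^(a) x₂^(b)`. -/
def DivPow (F : Type*) : Type _ := Fin 5 × Fin 5 → F

namespace DivPow

variable {F : Type*}

@[ext] theorem ext {f g : DivPow F} (h : ∀ c, f c = g c) : f = g := funext h

/-- The basis monomial `x₁^(a) x₂^(b)`. -/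
def mono [Zero F] [One F] (a b : Fin 5) : DivPow F := fun c => if c = (a, b) then 1 else 0

instance [AddCommGroup F] : AddCommGroup (DivPow F) :=
  inferInstanceAs (AddCommGroup (Fin 5 × Fin 5 → F))

instance [CommRing F] : Module F (DivPow F) :=
  inferInstanceAs (Module F (Fin 5 × Fin 5 → F))

theorem add_apply [AddCommGroup F] (f g : DivPow F) (c) : (f + g) c = f c + g c := rfl
theorem zero_apply [AddCommGroup F] (c) : (0 : DivPow F) c = 0 := rfl
theorem smul_apply [CommRing F] (r : F) (f : DivPow F) (c) : (r • f) c = r * f c := rfl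

/-- The coefficient `binom(c₁, a₁) binom(c₂, a₂)`; it vanishes unless `a ≤ c`. -/
def binom (c a : Fin 5 × Fin 5) : ℕ := Nat.choose c.1 a.1 * Nat.choose c.2 a.2

/-- The unit `x₁^(0) x₂^(0)`. -/
instance [CommRing F] : One (DivPow F) := ⟨mono 0 0⟩

/-- The product `x^(a) x^(b) = binom(a + b, a) x^(a + b)`, which is `0` if `a + b` has an entry
greater than `4`. In the sum, the terms in which `a ≤ c` fails have coefficient `0`, so the
wrap-around of `c - a` in `Fin 5` plays no role. -/
instance [CommRing F] : Mul (DivPow F) :=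
  ⟨fun f g c => ∑ a : Fin 5 × Fin 5, (binom c a : F) * f a * g (c - a)⟩

theorem mul_apply [CommRing F] (f g : DivPow F) (c) :
    (f * g) c = ∑ a : Fin 5 × Fin 5, (binom c a : F) * f a * g (c - a) := rfl

theorem one_apply [CommRing F] (c : Fin 5 × Fin 5) :
    (1 : DivPow F) c = if c = 0 then 1 else 0 := rfl

theorem choose_sub (c a : Fin 5) :
    Nat.choose c.val (c - a).val = Nat.choose c.val a.val := by
  revert c a; decide

theorem choose_mul_choose (c a b : Fin 5) :
    Nat.choose c.val a.val * Nat.choose a.val b.val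
      = Nat.choose c.val b.val * Nat.choose (c - b).val (a - b).val := by
  revert c a b; decide

theorem binom_sub (c a : Fin 5 × Fin 5) : binom c (c - a) = binom c a := by
  simp only [binom, Prod.fst_sub, Prod.snd_sub, choose_sub]

theorem binom_mul_binom (c a b : Fin 5 × Fin 5) :
    binom c a * binom a b = binom c b * binom (c - b) (a - b) := by
  have h1 := choose_mul_choose c.1 a.1 b.1
  have h2 := choose_mul_choose c.2 a.2 b.2
  simp only [binom, Prod.fst_sub, Prod.snd_sub]
  calc _ = (Nat.choose c.1 a.1 * Nat.choose a.1 b.1)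
        * (Nat.choose c.2 a.2 * Nat.choose a.2 b.2) := by ring
    _ = _ := by rw [h1, h2]; ring

section Ring

variable [CommRing F]

theorem dp_mul_comm (f g : DivPow F) : f * g = g * f := by
  ext c
  rw [mul_apply, mul_apply, ← Equiv.sum_comp (Equiv.subLeft c)]
  refine Finset.sum_congr rfl fun a _ => ?_
  simp only [Equiv.subLeft_apply, binom_sub, sub_sub_cancel]
  ring

theorem dp_mul_assoc (f g h : DivPow F) : f * g * h = f * (g * h) := by
  ext c
  simp only [mul_apply, Finset.mul_sum, Finset.sum_mul]
  rw [Finset.sum_comm]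
  refine Finset.sum_congr rfl fun b _ => ?_
  rw [← Equiv.sum_comp (Equiv.subRight b)
    (fun a => (binom c b : F) * f b * ((binom (c - b) a : F) * g a * h (c - b - a)))]
  refine Finset.sum_congr rfl fun a _ => ?_
  have hb : (binom c a : F) * binom a b = binom c b * binom (c - b) (a - b) := by
    exact_mod_cast congrArg (Nat.cast (R := F)) (binom_mul_binom c a b)
  have hs : c - b - (a - b) = c - a := by abel
  simp only [Equiv.subRight_apply, hs]
  linear_combination f b * g (a - b) * h (c - a) * hb

theorem dp_one_mul (f : DivPow F) : 1 * f = f := by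
  ext c
  rw [mul_apply, Finset.sum_eq_single 0]
  · simp [one_apply, binom]
  · intro a _ ha
    simp [one_apply, ha]
  · simp

theorem dp_left_distrib (f g h : DivPow F) : f * (g + h) = f * g + f * h := by
  ext c
  simp only [mul_apply, add_apply, ← Finset.sum_add_distrib]
  exact Finset.sum_congr rfl fun a _ => by ring

instance : CommRing (DivPow F) where
  __ := (inferInstance : AddCommGroup (DivPow F))
  mul_assoc := dp_mul_assoc
  mul_comm := dp_mul_comm
  one_mul := dp_one_mul
  mul_one f := by rw [dp_mul_comm, dp_one_mul]
  left_distrib := dp_left_distrib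
  right_distrib f g h := by
    rw [dp_mul_comm, dp_left_distrib, dp_mul_comm h f, dp_mul_comm h g]
  zero_mul f := by ext c; simp [mul_apply, zero_apply]
  mul_zero f := by ext c; simp [mul_apply, zero_apply]

theorem dp_smul_mul (r : F) (f g : DivPow F) : r • f * g = r • (f * g) := by
  ext c
  simp only [mul_apply, smul_apply, Finset.mul_sum]
  exact Finset.sum_congr rfl fun a _ => by ring

theorem dp_mul_smul (r : F) (f g : DivPow F) : f * r • g = r • (f * g) := by
  rw [mul_comm, dp_smul_mul, mul_comm]

instance : Algebra F (DivPow F) := Algebra.ofModule dp_smul_mul dp_mul_smul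

/-- The derivation `∂₁` of `𝒪(2; (1,1))`: `∂₁ (x₁^(a) x₂^(b)) = x₁^(a - 1) x₂^(b)`. -/
def d₁ : DivPow F →ₗ[F] DivPow F where
  toFun f c := if c.1 = 4 then 0 else f (c.1 + 1, c.2)
  map_add' f g := by
    ext c
    change (if c.1 = 4 then (0 : F) else _) =
      (if c.1 = 4 then (0 : F) else _) + (if c.1 = 4 then (0 : F) else _)
    by_cases h : c.1 = 4 <;> simp [add_apply, h]
  map_smul' r f := by
    ext c
    change (if c.1 = 4 then 0 else _) = r * (if c.1 = 4 then 0 else _)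
    by_cases h : c.1 = 4 <;> simp [smul_apply, h]

/-- The derivation `∂₂` of `𝒪(2; (1,1))`: `∂₂ (x₁^(a) x₂^(b)) = x₁^(a) x₂^(b - 1)`. -/
def d₂ : DivPow F →ₗ[F] DivPow F where
  toFun f c := if c.2 = 4 then 0 else f (c.1, c.2 + 1)
  map_add' f g := by
    ext c
    change (if c.2 = 4 then (0 : F) else _) =
      (if c.2 = 4 then (0 : F) else _) + (if c.2 = 4 then (0 : F) else _)
    by_cases h : c.2 = 4 <;> simp [add_apply, h]
  map_smul' r f := by
    ext c
    change (if c.2 = 4 then 0 else _) = r * (if c.2 = 4 then 0 else _)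
    by_cases h : c.2 = 4 <;> simp [smul_apply, h]

theorem d₁_apply (f : DivPow F) (c) : d₁ f c = if c.1 = 4 then 0 else f (c.1 + 1, c.2) := rfl
theorem d₂_apply (f : DivPow F) (c) : d₂ f c = if c.2 = 4 then 0 else f (c.1, c.2 + 1) := rfl

theorem d₁_d₂ (f : DivPow F) : d₁ (d₂ f) = d₂ (d₁ f) := by
  ext c
  simp only [d₁_apply, d₂_apply]
  split_ifs <;> rfl

theorem choose_leibniz (c a : Fin 5) :
    (if c = 4 then 0 else (Nat.choose (c + 1).val a.val : ZMod 5))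
      = (if a = 0 then 0 else (Nat.choose c.val (a - 1).val : ZMod 5))
        + if c - a = 4 then 0 else (Nat.choose c.val a.val : ZMod 5) := by
  revert c a; decide

theorem choose_leibniz_cast [CharP F 5] (c a : Fin 5) :
    (if c = 4 then 0 else (Nat.choose (c + 1).val a.val : F))
      = (if a = 0 then 0 else (Nat.choose c.val (a - 1).val : F))
        + if c - a = 4 then 0 else (Nat.choose c.val a.val : F) := by
  have h := congrArg (ZMod.castHom (dvd_refl 5) F) (choose_leibniz c a)
  simpa only [map_add, apply_ite (ZMod.castHom (dvd_refl 5) F), map_zero, map_natCast] using h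

theorem sub_one_eq_four (a : Fin 5) : a - 1 = 4 ↔ a = 0 := by
  revert a; decide

theorem d₁_mul [CharP F 5] (f g : DivPow F) : d₁ (f * g) = d₁ f * g + f * d₁ g := by
  ext c
  obtain ⟨c1, c2⟩ := c
  have key : ∀ a : Fin 5 × Fin 5,
      (if c1 = 4 then 0 else (Nat.choose (c1 + 1).val a.1.val : F))
        * Nat.choose c2.val a.2.val * f a * g ((c1 + 1, c2) - a)
      = (binom (c1, c2) (a - (1, 0)) : F) * d₁ f (a - (1, 0)) * g ((c1, c2) - (a - (1, 0)))
        + (binom (c1, c2) a : F) * f a * d₁ g ((c1, c2) - a) := by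
    rintro ⟨a1, a2⟩
    have e1 : (c1, c2) - ((a1, a2) - ((1 : Fin 5), (0 : Fin 5))) = (c1 + 1, c2) - (a1, a2) := by
      ext1 <;> simp; abel
    have e2 : c1 - a1 + 1 = c1 + 1 - a1 := by abel
    have e3 : a1 - 1 = 4 ↔ a1 = 0 := sub_one_eq_four a1
    rw [choose_leibniz_cast, e1]
    simp only [d₁_apply, binom, Prod.mk_sub_mk, sub_zero, sub_add_cancel, e2, e3]
    split_ifs <;> push_cast <;> ring
  have h : (d₁ (f * g)) (c1, c2) = ∑ a : Fin 5 × Fin 5,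
      (if c1 = 4 then 0 else (Nat.choose (c1 + 1).val a.1.val : F))
        * Nat.choose c2.val a.2.val * f a * g ((c1 + 1, c2) - a) := by
    rw [d₁_apply]
    by_cases hc : c1 = 4 <;> simp [hc, mul_apply, binom]
  rw [h, Finset.sum_congr rfl fun a _ => key a, Finset.sum_add_distrib, add_apply, mul_apply,
    mul_apply]
  congr 1
  exact Equiv.sum_comp (Equiv.subRight ((1 : Fin 5), (0 : Fin 5)))
    (fun a => (binom (c1, c2) a : F) * d₁ f a * g ((c1, c2) - a))

theorem d₂_mul [CharP F 5] (f g : DivPow F) : d₂ (f * g) = d₂ f * g + f * d₂ g := by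
  ext c
  obtain ⟨c1, c2⟩ := c
  have key : ∀ a : Fin 5 × Fin 5,
      (if c2 = 4 then 0 else (Nat.choose (c2 + 1).val a.2.val : F))
        * Nat.choose c1.val a.1.val * f a * g ((c1, c2 + 1) - a)
      = (binom (c1, c2) (a - (0, 1)) : F) * d₂ f (a - (0, 1)) * g ((c1, c2) - (a - (0, 1)))
        + (binom (c1, c2) a : F) * f a * d₂ g ((c1, c2) - a) := by
    rintro ⟨a1, a2⟩
    have e1 : (c1, c2) - ((a1, a2) - ((0 : Fin 5), (1 : Fin 5))) = (c1, c2 + 1) - (a1, a2) := by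
      ext1 <;> simp; abel
    have e2 : c2 - a2 + 1 = c2 + 1 - a2 := by abel
    have e3 : a2 - 1 = 4 ↔ a2 = 0 := sub_one_eq_four a2
    rw [choose_leibniz_cast, e1]
    simp only [d₂_apply, binom, Prod.mk_sub_mk, sub_zero, sub_add_cancel, e2, e3]
    split_ifs <;> push_cast <;> ring
  have h : (d₂ (f * g)) (c1, c2) = ∑ a : Fin 5 × Fin 5,
      (if c2 = 4 then 0 else (Nat.choose (c2 + 1).val a.2.val : F))
        * Nat.choose c1.val a.1.val * f a * g ((c1, c2 + 1) - a) := by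
    rw [d₂_apply]
    by_cases hc : c2 = 4
    · simp [hc]
    · simp only [hc, if_false, mul_apply, binom]
      exact Finset.sum_congr rfl fun a _ => by push_cast; ring
  rw [h, Finset.sum_congr rfl fun a _ => key a, Finset.sum_add_distrib, add_apply, mul_apply,
    mul_apply]
  congr 1
  exact Equiv.sum_comp (Equiv.subRight ((0 : Fin 5), (1 : Fin 5)))
    (fun a => (binom (c1, c2) a : F) * d₂ f a * g ((c1, c2) - a))

instance [CharP F 5] : CharP (DivPow F) 5 :=
  charP_of_injective_algebraMap (R := F) (fun r s h => by
    have h0 := congrFun h 0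
    simpa [Algebra.algebraMap_eq_smul_one, smul_apply, one_apply] using h0) 5

theorem d₁_two [CharP F 5] : d₁ (2 : DivPow F) = 0 := by
  have h := d₁_mul (1 : DivPow F) 1
  have h1 : d₁ (1 : DivPow F) = 0 := by simpa using h
  rw [← one_add_one_eq_two, map_add, h1, add_zero]

theorem d₂_two [CharP F 5] : d₂ (2 : DivPow F) = 0 := by
  have h := d₂_mul (1 : DivPow F) 1
  have h1 : d₂ (1 : DivPow F) = 0 := by simpa using h
  rw [← one_add_one_eq_two, map_add, h1, add_zero]

end Ring

end DivPow

/-- `W(2; (1,1))`: the pair `(u₁, u₂)` stands for the derivation `u₁ ∂₁ + u₂ ∂₂` of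
`𝒪(2; (1,1))`. -/
abbrev WittAlg (F : Type*) : Type _ := DivPow F × DivPow F

namespace WittAlg

open DivPow

variable {F : Type*} [CommRing F]

/-- The action `D(f) = u₁ ∂₁(f) + u₂ ∂₂(f)` of `D = u₁ ∂₁ + u₂ ∂₂` on `𝒪(2; (1,1))`. -/
def app (D : WittAlg F) (f : DivPow F) : DivPow F := D.1 * d₁ f + D.2 * d₂ f

/-- The divergence `div(u₁ ∂₁ + u₂ ∂₂) = ∂₁(u₁) + ∂₂(u₂)`. -/
def div (D : WittAlg F) : DivPow F := d₁ D.1 + d₂ D.2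

/-- The commutator `[D, E]` of derivations. -/
def brak (D E : WittAlg F) : WittAlg F :=
  (D.app E.1 - E.app D.1, D.app E.2 - E.app D.2)

/-- The derivation `D_f = ∂₁(f) ∂₂ - ∂₂(f) ∂₁`. -/
def ham (f : DivPow F) : WittAlg F := (-d₂ f, d₁ f)

end WittAlg

/-- The restricted Melikian algebra `ℳ(1,1) = 𝒪(2; (1,1)) ⊕ W(2; (1,1)) ⊕ W(2; (1,1))~` over a
field `F` of characteristic `5`. The triple `(f, D, E)` stands for `f + D + E~`, where `E~` is
the copy of `E` in the second copy `W(2; (1,1))~` of the space `W(2; (1,1))`. -/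
def Melikian (F : Type*) : Type _ := DivPow F × WittAlg F × WittAlg F

namespace Melikian

open DivPow WittAlg

variable {F : Type*}

instance [CommRing F] : AddCommGroup (Melikian F) :=
  inferInstanceAs (AddCommGroup (DivPow F × WittAlg F × WittAlg F))

instance [CommRing F] : Module F (Melikian F) :=
  inferInstanceAs (Module F (DivPow F × WittAlg F × WittAlg F))

/-- The component in `𝒪(2; (1,1))`. -/
def fn (x : Melikian F) : DivPow F := x.1

/-- The component in `W(2; (1,1))`. -/
def vec (x : Melikian F) : WittAlg F := x.2.1

/-- The component in `W(2; (1,1))~`. -/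
def til (x : Melikian F) : WittAlg F := x.2.2

theorem ext_comp {x y : Melikian F} (h0 : x.fn = y.fn) (h1 : x.vec.1 = y.vec.1)
    (h2 : x.vec.2 = y.vec.2) (h3 : x.til.1 = y.til.1) (h4 : x.til.2 = y.til.2) : x = y :=
  Prod.ext h0 (Prod.ext (Prod.ext h1 h2) (Prod.ext h3 h4))

section Ring

variable [CommRing F]

/-- The bracket of `ℳ(1,1)`. On `W(2; (1,1))` it is the commutator of derivations, and for
`D, E ∈ W(2; (1,1))`, `f, g ∈ 𝒪(2; (1,1))`,
* `[D, E~] = [D, E]~ + 2 div(D) E~`,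
* `[D, f] = D(f) - 2 div(D) f`,
* `[f, E~] = f E`,
* `[f, g] = 2 (f D_g - g D_f)~` with `D_f = ∂₁(f) ∂₂ - ∂₂(f) ∂₁`,
* `[(u₁ ∂₁ + u₂ ∂₂)~, (v₁ ∂₁ + v₂ ∂₂)~] = u₁ v₂ - u₂ v₁`. -/
instance : Bracket (Melikian F) (Melikian F) where
  bracket x y :=
    ( (x.vec.app y.fn - 2 * x.vec.div * y.fn) - (y.vec.app x.fn - 2 * y.vec.div * x.fn)
        + (x.til.1 * y.til.2 - x.til.2 * y.til.1),
      x.vec.brak y.vec + x.fn • y.til - y.fn • x.til,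
      (x.vec.brak y.til + (2 * x.vec.div) • y.til) - (y.vec.brak x.til + (2 * y.vec.div) • x.til)
        + (2 : DivPow F) • (x.fn • ham y.fn - y.fn • ham x.fn) )

theorem add_fn (x y : Melikian F) : (x + y).fn = x.fn + y.fn := rfl
theorem add_vec (x y : Melikian F) : (x + y).vec = x.vec + y.vec := rfl
theorem add_til (x y : Melikian F) : (x + y).til = x.til + y.til := rfl
theorem zero_fn : (0 : Melikian F).fn = 0 := rfl
theorem zero_vec : (0 : Melikian F).vec = 0 := rfl
theorem zero_til : (0 : Melikian F).til = 0 := rfl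
theorem smul_fn (r : F) (x : Melikian F) : (r • x).fn = r • x.fn := rfl
theorem smul_vec (r : F) (x : Melikian F) : (r • x).vec = r • x.vec := rfl
theorem smul_til (r : F) (x : Melikian F) : (r • x).til = r • x.til := rfl

theorem lie_fn (x y : Melikian F) : ⁅x, y⁆.fn =
    (x.vec.app y.fn - 2 * x.vec.div * y.fn) - (y.vec.app x.fn - 2 * y.vec.div * x.fn)
      + (x.til.1 * y.til.2 - x.til.2 * y.til.1) := rfl

theorem lie_vec (x y : Melikian F) : ⁅x, y⁆.vec =
    x.vec.brak y.vec + x.fn • y.til - y.fn • x.til := rfl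

theorem lie_til (x y : Melikian F) : ⁅x, y⁆.til =
    (x.vec.brak y.til + (2 * x.vec.div) • y.til) - (y.vec.brak x.til + (2 * y.vec.div) • x.til)
      + (2 : DivPow F) • (x.fn • ham y.fn - y.fn • ham x.fn) := rfl

theorem mel_add_lie (x y z : Melikian F) : ⁅x + y, z⁆ = ⁅x, z⁆ + ⁅y, z⁆ := by
  apply ext_comp <;>
  simp only [lie_fn, lie_vec, lie_til, add_fn, add_vec, add_til, app, div, brak, ham, Prod.fst_add,
    Prod.snd_add, Prod.fst_sub, Prod.snd_sub, Prod.smul_fst, Prod.smul_snd, smul_eq_mul,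
    map_add] <;> ring

theorem mel_lie_self (x : Melikian F) : ⁅x, x⁆ = 0 := by
  apply ext_comp <;>
  simp only [lie_fn, lie_vec, lie_til, zero_fn, zero_vec, zero_til, app, div, brak, ham,
    Prod.fst_add, Prod.snd_add, Prod.fst_sub, Prod.snd_sub, Prod.smul_fst, Prod.smul_snd,
    Prod.fst_zero, Prod.snd_zero, smul_eq_mul] <;> ring

theorem mel_lie_add (x y z : Melikian F) : ⁅x, y + z⁆ = ⁅x, y⁆ + ⁅x, z⁆ := by
  apply ext_comp <;>
  simp only [lie_fn, lie_vec, lie_til, add_fn, add_vec, add_til, app, div, brak, ham, Prod.fst_add,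
    Prod.snd_add, Prod.fst_sub, Prod.snd_sub, Prod.smul_fst, Prod.smul_snd, smul_eq_mul,
    map_add] <;> ring

theorem mel_lie_smul (r : F) (x y : Melikian F) : ⁅x, r • y⁆ = r • ⁅x, y⁆ := by
  apply ext_comp <;>
  simp only [lie_fn, lie_vec, lie_til, smul_fn, smul_vec, smul_til, app, div, brak, ham,
    Prod.fst_add, Prod.snd_add, Prod.fst_sub, Prod.snd_sub, Prod.smul_fst, Prod.smul_snd,
    smul_eq_mul, map_smul] <;>
  simp only [Algebra.smul_def] <;> ring

set_option maxHeartbeats 1000000 in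
theorem mel_leibniz [CharP F 5] (x y z : Melikian F) :
    ⁅x, ⁅y, z⁆⁆ = ⁅⁅x, y⁆, z⁆ + ⁅y, ⁅x, z⁆⁆ := by
  have h5 : (5 : DivPow F) = 0 := by exact_mod_cast CharP.cast_eq_zero (DivPow F) 5
  have h10 : (10 : DivPow F) = 0 := by linear_combination 2 * h5
  apply ext_comp <;> rw [← sub_eq_zero] <;>
  simp only [lie_fn, lie_vec, lie_til, add_fn, add_vec, add_til, app, div, brak, ham,
    Prod.fst_add, Prod.snd_add, Prod.fst_sub, Prod.snd_sub, Prod.smul_fst, Prod.smul_snd,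
    smul_eq_mul, map_add, map_sub, map_neg, d₁_mul, d₂_mul, d₁_two, d₂_two, d₁_d₂] <;>
  ring_nf <;>
  simp only [h5, h10, mul_zero, neg_zero, add_zero, sub_zero]

instance [CharP F 5] : LieRing (Melikian F) where
  add_lie := mel_add_lie
  lie_add := mel_lie_add
  lie_self := mel_lie_self
  leibniz_lie := mel_leibniz

instance [CharP F 5] : LieAlgebra F (Melikian F) where
  lie_smul := mel_lie_smul

end Ring

end Melikian

/-- The space `B²(L, V)` of coboundaries of `1`-cochains, in the space of bilinear maps. -/
def LieB2 (R L V : Type*) [CommRing R] [LieRing L] [LieAlgebra R L] [AddCommGroup V]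
    [Module R V] [LieRingModule L V] [LieModule R L V] : Submodule R (L →ₗ[R] L →ₗ[R] V) :=
  (LinearMap.range (LieModule.Cohomology.d₁₂ R L V)).map
    (LieModule.Cohomology.twoCochain R L V).subtype

/-- The space `Z²(L, V)` of alternating `2`-cocycles, in the space of bilinear maps. -/
def LieZ2 (R L V : Type*) [CommRing R] [LieRing L] [LieAlgebra R L] [AddCommGroup V]
    [Module R V] [LieRingModule L V] [LieModule R L V] : Submodule R (L →ₗ[R] L →ₗ[R] V) :=
  (LieModule.Cohomology.twoCocycle R L V).map (LieModule.Cohomology.twoCochain R L V).subtype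

/-- The second cohomology group `H²(L, V) = Z²(L, V) / B²(L, V)` of a Lie algebra `L` over `R`
with coefficients in an `L`-module `V`, realised inside the quotient of the space of all bilinear
maps by `B²(L, V)`. -/
def LieH2 (R L V : Type*) [CommRing R] [LieRing L] [LieAlgebra R L] [AddCommGroup V]
    [Module R V] [LieRingModule L V] [LieModule R L V] :
    Submodule R ((L →ₗ[R] L →ₗ[R] V) ⧸ LieB2 R L V) :=
  (LieZ2 R L V).map (LieB2 R L V).mkQ

/-! A trivial `2`-cocycle is invariant under its radical, which is a subalgebra. The torus elements
`x₁ ∂₁` and `x₂ ∂₂` are toral, `(ad t) ^ 5 = ad t`, so coboundaries can be subtracted from a cocycle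
`ω` until both lie in its radical; then `ω` pairs only opposite weights. A primitive along `∂₁` and
`∂₂` has weight zero, and subtracting its coboundary puts `∂₁` and `∂₂` into the radical as well.
Invariance under these derivations now makes `ω` vanish on pairs of monomials whose exponents in
`x₁` or in `x₂` add up to less than `4`, and determines it up to sign by `ω (x₁^(4) x₂^(4), 1)` in
each pair of components when both sums are `4`. Together with the weights this leaves enough
monomials in the radical to generate the top monomials `x₁^(4) x₂^(4)` of all five components, and
`∂₁`, `∂₂` carry these to every basis element: `ω = 0`.

So every trivial cocycle of the algebra, with any coefficients, is a coboundary. The defect of a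
linear section of a central extension `E` is such a cocycle with values in `E`, and since the
algebra is perfect, a primitive of it corrects the section to a splitting. -/

section CentralExtensions

variable {R L M : Type*} [CommRing R] [LieRing L] [LieAlgebra R L] [LieRing M] [LieAlgebra R M]

/-- A `2`-cocycle of `L` with coefficients in the module `V` on which `L` acts trivially. -/
structure IsTrivialCocycle {V : Type*} [AddCommGroup V] [Module R V]
    (ω : L →ₗ[R] L →ₗ[R] V) : Prop where
  alt : ω.IsAlt
  leibniz : ∀ x y z, ω x ⁅y, z⁆ = ω ⁅x, y⁆ z + ω y ⁅x, z⁆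

/-- The coboundary `(x, y) ↦ f ⁅x, y⁆` of a `1`-cochain `f` with trivial coefficients; the usual
sign is dropped. -/
def trivialCoboundary {V : Type*} [AddCommGroup V] [Module R V] (f : L →ₗ[R] V) :
    L →ₗ[R] L →ₗ[R] V :=
  (LieModule.toEnd R L L : L →ₗ[R] Module.End R L).compr₂ f

@[simp] theorem trivialCoboundary_apply {V : Type*} [AddCommGroup V] [Module R V] (f : L →ₗ[R] V)
    (x y : L) : trivialCoboundary f x y = f ⁅x, y⁆ := rfl

theorem trivialCoboundary_add {V : Type*} [AddCommGroup V] [Module R V] (f g : L →ₗ[R] V) :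
    trivialCoboundary (f + g) = trivialCoboundary f + trivialCoboundary g := rfl

theorem lie_mem_derivedSeries_one (x y : L) : ⁅x, y⁆ ∈ LieAlgebra.derivedSeries R L 1 :=
  LieSubmodule.lie_mem_lie (LieSubmodule.mem_top x) (LieSubmodule.mem_top y)

theorem eqOn_derivedSeries_one {V : Type*} [AddCommGroup V] [Module R V] {f g : L →ₗ[R] V}
    (h : ∀ x y : L, f ⁅x, y⁆ = g ⁅x, y⁆) : Set.EqOn f g (LieAlgebra.derivedSeries R L 1) := by
  change Set.EqOn f g (LieAlgebra.derivedSeries R L 1 : LieSubalgebra R L).toSubmodule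
  rw [LieAlgebra.coe_derivedSeries_one_eq]
  refine LinearMap.eqOn_span ?_
  rintro _ ⟨x, y, rfl⟩
  exact h x y

theorem linearMap_ext_of_perfect {V : Type*} [AddCommGroup V] [Module R V]
    (hL : LieAlgebra.derivedSeries R L 1 = ⊤) {f g : L →ₗ[R] V}
    (h : ∀ x y : L, f ⁅x, y⁆ = g ⁅x, y⁆) : f = g :=
  LinearMap.ext fun x => eqOn_derivedSeries_one h (hL ▸ LieSubmodule.mem_top x)

theorem lieH2_eq_bot {V : Type*} [AddCommGroup V] [Module R V] [LieRingModule L V]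
    [LieModule R L V] [LieModule.IsTrivial L V]
    (h : ∀ ω : L →ₗ[R] L →ₗ[R] V, IsTrivialCocycle ω → ∃ f, ω = trivialCoboundary f) :
    LieH2 R L V = ⊥ := by
  rw [LieH2, eq_bot_iff, Submodule.map_le_iff_le_comap]
  rintro _ ⟨c, hc, rfl⟩
  rw [Submodule.mem_comap, Submodule.mem_bot, Submodule.mkQ_apply, Submodule.Quotient.mk_eq_zero]
  obtain ⟨f, hf⟩ :=
    h c.1 ⟨c.2, (LieModule.Cohomology.mem_twoCocycle_iff_of_trivial R L V c).mp hc⟩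
  refine ⟨LieModule.Cohomology.d₁₂ R L V (-f), ⟨-f, rfl⟩, ?_⟩
  ext x y
  calc LieModule.Cohomology.d₁₂ R L V (-f) x y = -(-f) ⁅x, y⁆ :=
        LieModule.Cohomology.d₁₂_apply_apply_ofTrivial R L V (-f) x y
    _ = c.1 x y := by rw [hf, LinearMap.neg_apply, neg_neg, trivialCoboundary_apply]

theorem lie_eq_lie_of_ker_le_center {p : L →ₗ⁅R⁆ M} (hp : p.ker ≤ LieAlgebra.center R L)
    {x x' y y' : L} (hx : p x = p x') (hy : p y = p y') : ⁅x, y⁆ = ⁅x', y'⁆ := by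
  have central {u u' : L} (hu : p u = p u') (z : L) : ⁅z, u⁆ = ⁅z, u'⁆ := by
    have hmem : u - u' ∈ p.ker := by rw [LieHom.mem_ker, map_sub, hu, sub_self]
    rw [← sub_eq_zero, ← lie_sub]
    exact (LieModule.mem_maxTrivSubmodule R L L _).mp (hp hmem) z
  rw [central hy, ← lie_skew, central hx, lie_skew]

/-- The failure of the linear map `σ` to preserve the bracket. -/
def bracketDefect (σ : M →ₗ[R] L) : M →ₗ[R] M →ₗ[R] L :=
  (LieModule.toEnd R L L : L →ₗ[R] Module.End R L).compl₁₂ σ σ - trivialCoboundary σ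

theorem bracketDefect_apply (σ : M →ₗ[R] L) (x y : M) :
    bracketDefect σ x y = ⁅σ x, σ y⁆ - σ ⁅x, y⁆ := rfl

theorem isTrivialCocycle_bracketDefect {p : L →ₗ⁅R⁆ M} (hp : p.ker ≤ LieAlgebra.center R L)
    {σ : M →ₗ[R] L} (hσ : ∀ x, p (σ x) = x) : IsTrivialCocycle (bracketDefect σ) where
  alt x := by rw [bracketDefect_apply, lie_self, lie_self, map_zero, sub_zero]
  leibniz x y z := by
    have lie_right (u v w : M) : ⁅σ u, σ ⁅v, w⁆⁆ = ⁅σ u, ⁅σ v, σ w⁆⁆ :=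
      lie_eq_lie_of_ker_le_center hp rfl (by rw [hσ, LieHom.map_lie, hσ, hσ])
    rw [bracketDefect_apply, bracketDefect_apply, bracketDefect_apply, lie_right, lie_right,
      ← lie_skew (σ ⁅x, y⁆), lie_right, lie_skew, leibniz_lie (σ x), leibniz_lie x, map_add]
    abel

/-- If the bracket defect of a linear section is the coboundary of `f`, then adding `f` to the
section gives a homomorphism; this is still a section because `p ∘ f` vanishes on brackets. -/
theorem exists_lieHom_section [Module.Projective R M] (hM : LieAlgebra.derivedSeries R M 1 = ⊤)
    (hH : ∀ ω : M →ₗ[R] M →ₗ[R] L, IsTrivialCocycle ω → ∃ f, ω = trivialCoboundary f)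
    {p : L →ₗ⁅R⁆ M} (hsurj : Function.Surjective p) (hp : p.ker ≤ LieAlgebra.center R L) :
    ∃ s : M →ₗ⁅R⁆ L, ∀ x, p (s x) = x := by
  obtain ⟨σ, hσ⟩ := Module.projective_lifting_property (p : L →ₗ[R] M) LinearMap.id hsurj
  replace hσ (x : M) : p (σ x) = x := LinearMap.congr_fun hσ x
  obtain ⟨f, hf⟩ := hH _ (isTrivialCocycle_bracketDefect hp hσ)
  replace hf (x y : M) : ⁅σ x, σ y⁆ - σ ⁅x, y⁆ = f ⁅x, y⁆ := LinearMap.congr_fun₂ hf x y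
  have hpf : (p : L →ₗ[R] M) ∘ₗ f = 0 := linearMap_ext_of_perfect hM fun x y => by
    rw [LinearMap.comp_apply, ← hf, LieHom.coe_toLinearMap, map_sub, LieHom.map_lie, hσ, hσ, hσ,
      sub_self, LinearMap.zero_apply]
  have hs (x : M) : p (σ x + f x) = x := by
    rw [map_add, hσ, show p (f x) = 0 from LinearMap.congr_fun hpf x, add_zero]
  refine ⟨{ σ + f with map_lie' := fun {x y} => ?_ }, hs⟩
  calc σ ⁅x, y⁆ + f ⁅x, y⁆ = ⁅σ x, σ y⁆ := by rw [← hf, add_sub_cancel]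
    _ = ⁅σ x + f x, σ y + f y⁆ := lie_eq_lie_of_ker_le_center hp (by rw [hσ, hs]) (by rw [hσ, hs])

section Split

variable {p : L →ₗ⁅R⁆ M} {s : M →ₗ⁅R⁆ L}

theorem mem_derivedSeries_one_iff_of_section (hM : LieAlgebra.derivedSeries R M 1 = ⊤)
    (hp : p.ker ≤ LieAlgebra.center R L) (hs : ∀ x, p (s x) = x) {x : L} :
    x ∈ LieAlgebra.derivedSeries R L 1 ↔ s (p x) = x := by
  constructor
  · refine @eqOn_derivedSeries_one R L _ _ _ L _ _ ((s : M →ₗ[R] L) ∘ₗ p) LinearMap.id ?_ x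
    intro y z
    calc s (p ⁅y, z⁆) = ⁅s (p y), s (p z)⁆ := by rw [LieHom.map_lie, LieHom.map_lie]
      _ = ⁅y, z⁆ := lie_eq_lie_of_ker_le_center hp (hs _) (hs _)
  · intro hx
    rw [← hx]
    refine LieIdeal.derivedSeries_map_le 1 (LieIdeal.mem_map (f := s) ?_)
    rw [hM]
    exact LieSubmodule.mem_top _

theorem isCompl_derivedSeries_one_ker (hM : LieAlgebra.derivedSeries R M 1 = ⊤)
    (hp : p.ker ≤ LieAlgebra.center R L) (hs : ∀ x, p (s x) = x) :
    IsCompl (LieAlgebra.derivedSeries R L 1) p.ker := by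
  constructor
  · rw [disjoint_iff_inf_le]
    rintro x ⟨hx, hpx⟩
    rw [LieSubmodule.mem_bot, ← (mem_derivedSeries_one_iff_of_section hM hp hs).mp hx,
      LieHom.mem_ker.mp hpx, map_zero]
  · rw [codisjoint_iff_le_sup]
    intro x _
    have hx : x - s (p x) ∈ p.ker := by rw [LieHom.mem_ker, map_sub, hs, sub_self]
    rw [← add_sub_cancel (s (p x)) x]
    exact add_mem
      (LieSubmodule.mem_sup_left <|
        (mem_derivedSeries_one_iff_of_section hM hp hs).mpr (by rw [hs]))
      (LieSubmodule.mem_sup_right hx)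

/-- The isomorphism `⁅L, L⁆ ≃ M` induced by a split central extension `p : L → M` of a perfect
Lie algebra. -/
noncomputable def derivedSeriesOneEquiv (hM : LieAlgebra.derivedSeries R M 1 = ⊤)
    (hp : p.ker ≤ LieAlgebra.center R L) (hs : ∀ x, p (s x) = x) :
    LieAlgebra.derivedSeries R L 1 ≃ₗ⁅R⁆ M :=
  LieEquiv.ofBijective (p.comp (LieAlgebra.derivedSeries R L 1).incl)
    ⟨fun x y hxy => Subtype.ext <| by
      rw [← (mem_derivedSeries_one_iff_of_section hM hp hs).mp x.2,
        ← (mem_derivedSeries_one_iff_of_section hM hp hs).mp y.2]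
      exact congrArg s hxy,
    fun z => ⟨⟨s z, (mem_derivedSeries_one_iff_of_section hM hp hs).mpr (by rw [hs])⟩, hs z⟩⟩

end Split

/-- The projection of `L` onto `L ⧸ I ≃ M`. -/
def projOfQuotientEquiv {I : LieIdeal R L} (φ : (L ⧸ I) ≃ₗ⁅R⁆ M) : L →ₗ⁅R⁆ M where
  toLinearMap := φ.toLinearEquiv.toLinearMap ∘ₗ I.toSubmodule.mkQ
  map_lie' {x y} := φ.map_lie (LieSubmodule.Quotient.mk x) (LieSubmodule.Quotient.mk y)

theorem ker_projOfQuotientEquiv {I : LieIdeal R L} (φ : (L ⧸ I) ≃ₗ⁅R⁆ M) :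
    (projOfQuotientEquiv φ).ker = I := by
  ext x
  rw [LieHom.mem_ker, ← LieSubmodule.Quotient.mk_eq_zero']
  exact map_eq_zero_iff φ φ.injective

theorem projOfQuotientEquiv_surjective {I : LieIdeal R L} (φ : (L ⧸ I) ≃ₗ⁅R⁆ M) :
    Function.Surjective (projOfQuotientEquiv φ) :=
  φ.surjective.comp (LieSubmodule.Quotient.surjective_mk' I)

theorem derivedSeries_one_equiv_and_isCompl_center [Module.Projective R M]
    (hM : LieAlgebra.derivedSeries R M 1 = ⊤)
    (hH : ∀ ω : M →ₗ[R] M →ₗ[R] L, IsTrivialCocycle ω → ∃ f, ω = trivialCoboundary f)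
    (φ : (L ⧸ LieAlgebra.center R L) ≃ₗ⁅R⁆ M) :
    Nonempty (LieAlgebra.derivedSeries R L 1 ≃ₗ⁅R⁆ M) ∧
      IsCompl (LieAlgebra.derivedSeries R L 1) (LieAlgebra.center R L) := by
  have hker := ker_projOfQuotientEquiv φ
  obtain ⟨s, hs⟩ := exists_lieHom_section hM hH (projOfQuotientEquiv_surjective φ) hker.le
  exact ⟨⟨derivedSeriesOneEquiv hM hker.le hs⟩,
    hker ▸ isCompl_derivedSeries_one_ker hM hker.le hs⟩

end CentralExtensions

section Weights

variable {R L : Type*} [CommRing R] [LieRing L] [LieAlgebra R L]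

theorem lie_lie_weight {t x y : L} {m n : ℤ} (hx : ⁅t, x⁆ = (m : R) • x)
    (hy : ⁅t, y⁆ = (n : R) • y) : ⁅t, ⁅x, y⁆⁆ = ((m + n : ℤ) : R) • ⁅x, y⁆ := by
  rw [leibniz_lie, hx, hy, smul_lie, lie_smul, ← add_smul, Int.cast_add]

theorem ad_pow_char_of_weightBasis (p : ℕ) [Fact p.Prime] [CharP R p] {ι : Type*}
    (b : Module.Basis ι R L) {w : ι → ℤ} {t : L} (hw : ∀ i, ⁅t, b i⁆ = (w i : R) • b i) :
    LieAlgebra.ad R L t ^ p = LieAlgebra.ad R L t := by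
  refine b.ext fun i => ?_
  have hpow (n : ℕ) : (LieAlgebra.ad R L t ^ n) (b i) = (w i : R) ^ n • b i := by
    induction n with
    | zero => simp
    | succ n ih => rw [pow_succ', Module.End.mul_apply, ih, map_smul, LieAlgebra.ad_apply, hw,
        smul_smul, pow_succ]
  rw [hpow, LieAlgebra.ad_apply, hw, ← frobenius_def, map_intCast]

end Weights

namespace IsTrivialCocycle

variable {R L V : Type*} [CommRing R] [LieRing L] [LieAlgebra R L] [AddCommGroup V] [Module R V]
  {ω : L →ₗ[R] L →ₗ[R] V}

theorem skew (h : IsTrivialCocycle ω) (x y : L) : ω x y = -ω y x := (h.alt.neg y x).symm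

theorem sub_trivialCoboundary (h : IsTrivialCocycle ω) (f : L →ₗ[R] V) :
    IsTrivialCocycle (ω - trivialCoboundary f) where
  alt x := by
    rw [LinearMap.sub_apply, LinearMap.sub_apply, h.alt, trivialCoboundary_apply, lie_self,
      map_zero, sub_zero]
  leibniz x y z := by
    simp only [LinearMap.sub_apply, trivialCoboundary_apply]
    rw [h.leibniz, leibniz_lie x, map_add]
    abel

/-- The radical of a cocycle; the cocycle is invariant under this subalgebra. -/
def radical (h : IsTrivialCocycle ω) : LieSubalgebra R L where
  __ := LinearMap.ker ω
  lie_mem' {x y} hx hy := by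
    have hx : ω x = 0 := hx
    have hy : ω y = 0 := hy
    refine LinearMap.ext fun z => ?_
    simpa [hx, hy] using (h.leibniz x y z).symm

theorem mem_radical (h : IsTrivialCocycle ω) {x : L} : x ∈ h.radical ↔ ω x = 0 := Iff.rfl

theorem apply_eq_zero_of_mem_radical (h : IsTrivialCocycle ω) {x : L} (hx : x ∈ h.radical)
    (y : L) : ω x y = 0 :=
  LinearMap.congr_fun (h.mem_radical.mp hx) y

theorem apply_lie_of_mem_radical (h : IsTrivialCocycle ω) {d : L} (hd : d ∈ h.radical) (x y : L) :
    ω ⁅d, x⁆ y = -ω x ⁅d, y⁆ := by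
  have hleibniz := h.leibniz d x y
  rw [h.apply_eq_zero_of_mem_radical hd] at hleibniz
  exact eq_neg_of_add_eq_zero_left hleibniz.symm

theorem apply_lie_comm (h : IsTrivialCocycle ω) {x y : L} (hxy : ⁅x, y⁆ = 0) (z : L) :
    ω x ⁅y, z⁆ = ω y ⁅x, z⁆ := by
  rw [h.leibniz, hxy, map_zero, LinearMap.zero_apply, zero_add]

theorem apply_lie_weight (h : IsTrivialCocycle ω) {t x y : L} {m n : ℤ}
    (hx : ⁅t, x⁆ = (m : R) • x) (hy : ⁅t, y⁆ = (n : R) • y) :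
    ω t ⁅x, y⁆ = ((m + n : ℤ) : R) • ω x y := by
  rw [h.leibniz, hx, hy, map_smul, map_smul, LinearMap.smul_apply, ← add_smul, Int.cast_add]

theorem eq_zero_of_weight {p : ℕ} [Fact p.Prime] [CharP R p] (h : IsTrivialCocycle ω) {t x y : L}
    (ht : t ∈ h.radical) {m n : ℤ} (hx : ⁅t, x⁆ = (m : R) • x) (hy : ⁅t, y⁆ = (n : R) • y)
    (hmn : ¬ (p : ℤ) ∣ m + n) : ω x y = 0 := by
  have happly := h.apply_lie_weight hx hy
  rw [h.apply_eq_zero_of_mem_radical ht] at happly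
  exact ((CharP.isUnit_intCast_iff Fact.out).mpr hmn).smul_eq_zero.mp happly.symm

/-- If `t` has weight `k` on `⁅x, y⁆`, then `ω t ⁅x, y⁆` vanishes either because `k = 0` or because
`⁅x, y⁆` is in the image of `ad t`. -/
theorem mem_radical_of_weightBasis (p : ℕ) [Fact p.Prime] [CharP R p] (h : IsTrivialCocycle ω)
    (hL : LieAlgebra.derivedSeries R L 1 = ⊤) {ι : Type*} (b : Module.Basis ι R L) {w : ι → ℤ}
    {t : L} (hw : ∀ i, ⁅t, b i⁆ = (w i : R) • b i) (ht : ∀ x, ω t ⁅t, x⁆ = 0) :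
    t ∈ h.radical := by
  refine linearMap_ext_of_perfect hL fun x y => LinearMap.congr_fun₂ (f := trivialCoboundary (ω t))
    (g := trivialCoboundary 0) (b.ext fun i => b.ext fun j => ?_) x y
  rw [trivialCoboundary_apply, trivialCoboundary_apply, LinearMap.zero_apply]
  by_cases hp : (p : ℤ) ∣ w i + w j
  · rw [h.apply_lie_weight (hw i) (hw j), (CharP.intCast_eq_zero_iff R p _).mpr hp, zero_smul]
  · have happly := ht ⁅b i, b j⁆
    rw [lie_lie_weight (hw i) (hw j), map_smul] at happly
    exact ((CharP.isUnit_intCast_iff Fact.out).mpr hp).smul_eq_zero.mp happly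

/-- The correction `ω t ∘ (ad t) ^ (p - 2)` makes `ω t` vanish on the image of `ad t`, since
`(ad t) ^ p = ad t`. -/
theorem exists_mem_radical_sub_trivialCoboundary (p : ℕ) [Fact p.Prime] [CharP R p]
    (h : IsTrivialCocycle ω) (hL : LieAlgebra.derivedSeries R L 1 = ⊤) {ι : Type*}
    (b : Module.Basis ι R L) {w : ι → ℤ} {t : L} (hw : ∀ i, ⁅t, b i⁆ = (w i : R) • b i) :
    ∃ f : L →ₗ[R] V, t ∈ (h.sub_trivialCoboundary f).radical ∧
      ∀ s ∈ h.radical, ⁅t, s⁆ = 0 → s ∈ (h.sub_trivialCoboundary f).radical := by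
  obtain ⟨n, hn⟩ : ∃ n, p = n + 2 := Nat.exists_eq_add_of_le' (Fact.out : p.Prime).two_le
  refine ⟨ω t ∘ₗ LieAlgebra.ad R L t ^ n, ?_, fun s hs hts => ?_⟩
  · refine mem_radical_of_weightBasis p _ hL b hw fun x => ?_
    have hpow : (LieAlgebra.ad R L t ^ n) ⁅t, ⁅t, x⁆⁆ = ⁅t, x⁆ := by
      have had := LinearMap.congr_fun (ad_pow_char_of_weightBasis p b hw) x
      rwa [hn, pow_add, pow_two] at had
    rw [LinearMap.sub_apply, LinearMap.sub_apply, trivialCoboundary_apply, LinearMap.comp_apply,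
      hpow, sub_self]
  · have hcomm : Commute (LieAlgebra.ad R L t) (LieAlgebra.ad R L s) := by
      refine LinearMap.ext fun x => ?_
      change ⁅t, ⁅s, x⁆⁆ = ⁅s, ⁅t, x⁆⁆
      rw [leibniz_lie, hts, zero_lie, zero_add]
    refine LinearMap.ext fun x => ?_
    have hswap : (LieAlgebra.ad R L t ^ n) ⁅s, x⁆ = ⁅s, (LieAlgebra.ad R L t ^ n) x⁆ :=
      LinearMap.congr_fun (hcomm.pow_left n) x
    rw [LinearMap.sub_apply, LinearMap.sub_apply, trivialCoboundary_apply, LinearMap.comp_apply,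
      hswap, h.apply_lie_comm hts, h.apply_eq_zero_of_mem_radical hs,
      h.apply_eq_zero_of_mem_radical hs, sub_zero, LinearMap.zero_apply]

end IsTrivialCocycle

namespace DivPow

variable {F : Type*} [CommRing F]

/-- The monomial `x₁^(a) x₂^(b)` with exponents in `ℕ`, so that exponents add without wrapping
around; it is `0` if `a` or `b` exceeds `4`. -/
def X (F : Type*) [CommRing F] (a b : ℕ) : DivPow F :=
  fun c => if c.1.val = a ∧ c.2.val = b then 1 else 0

theorem X_apply (a b : ℕ) (c : Fin 5 × Fin 5) :
    X F a b c = if c.1.val = a ∧ c.2.val = b then 1 else 0 := rfl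

theorem X_zero_zero : X F 0 0 = 1 := by
  ext c
  have zero_iff : (c.1.val = 0 ∧ c.2.val = 0) ↔ c = 0 := by
    rw [Prod.ext_iff, Fin.ext_iff, Fin.ext_iff]
    rfl
  simp only [X_apply, one_apply, zero_iff]

theorem X_eq_zero {a b : ℕ} (h : 4 < a ∨ 4 < b) : X F a b = 0 := by
  ext c
  rw [X_apply, zero_apply, if_neg]
  have := c.1.isLt
  have := c.2.isLt
  omega

theorem d₁_X_zero (b : ℕ) : d₁ (X F 0 b) = 0 := by
  ext c
  rw [d₁_apply, X_apply, zero_apply]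
  obtain ⟨c1, c2⟩ := c
  fin_cases c1 <;> simp

theorem d₂_X_zero (a : ℕ) : d₂ (X F a 0) = 0 := by
  ext c
  rw [d₂_apply, X_apply, zero_apply]
  obtain ⟨c1, c2⟩ := c
  fin_cases c2 <;> simp

theorem d₁_X_succ {a : ℕ} (h : a < 4) (b : ℕ) : d₁ (X F (a + 1) b) = X F a b := by
  ext c
  rw [d₁_apply, X_apply, X_apply]
  obtain ⟨c1, c2⟩ := c
  interval_cases a <;> fin_cases c1 <;> simp

theorem d₂_X_succ (a : ℕ) {b : ℕ} (h : b < 4) : d₂ (X F a (b + 1)) = X F a b := by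
  ext c
  rw [d₂_apply, X_apply, X_apply]
  obtain ⟨c1, c2⟩ := c
  interval_cases b <;> fin_cases c2 <;> simp

theorem X_mul_X (a b c d : ℕ) :
    X F a b * X F c d = ((a + c).choose a * (b + d).choose b : ℕ) • X F (a + c) (b + d) := by
  by_cases hab : a < 5 ∧ b < 5
  swap
  · rw [X_eq_zero (a := a) (by omega), X_eq_zero (a := a + c) (by omega), zero_mul, smul_zero]
  ext ⟨p, q⟩
  rw [mul_apply, Finset.sum_eq_single ((⟨a, hab.1⟩ : Fin 5), (⟨b, hab.2⟩ : Fin 5)),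
    ← Nat.cast_smul_eq_nsmul F, smul_apply]
  · simp only [X_apply, Prod.mk_sub_mk, and_self, if_true, mul_one, binom]
    by_cases hle : a ≤ p.val ∧ b ≤ q.val
    · have hpa : (p - ⟨a, hab.1⟩ : Fin 5).val = p.val - a := Fin.sub_val_of_le hle.1
      have hqb : (q - ⟨b, hab.2⟩ : Fin 5).val = q.val - b := Fin.sub_val_of_le hle.2
      rw [hpa, hqb]
      by_cases hpq : p.val = a + c ∧ q.val = b + d
      · rw [if_pos (by omega), if_pos hpq, hpq.1, hpq.2]
      · rw [if_neg (by omega), if_neg hpq, mul_zero, mul_zero]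
    · have hchoose : (p.val.choose a * q.val.choose b : ℕ) = 0 := by
        rw [Nat.mul_eq_zero, Nat.choose_eq_zero_iff, Nat.choose_eq_zero_iff]
        omega
      rw [hchoose, Nat.cast_zero, zero_mul, if_neg (by omega), mul_zero]
  · rintro ⟨r, s⟩ - hrs
    rw [X_apply, if_neg, mul_zero, zero_mul]
    simpa [Prod.ext_iff, Fin.ext_iff] using hrs
  · simp

theorem X_mul_d₁_X (a b : ℕ) : X F 1 0 * d₁ (X F a b) = (a : F) • X F a b := by
  by_cases h : a < 5
  · cases a with
    | zero => simp [d₁_X_zero]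
    | succ a =>
      rw [d₁_X_succ (by omega), X_mul_X, Nat.cast_smul_eq_nsmul F]
      simp [add_comm 1 a]
  · simp [X_eq_zero (F := F) (a := a) (b := b) (by omega)]

theorem X_mul_d₂_X (a b : ℕ) : X F 0 1 * d₂ (X F a b) = (b : F) • X F a b := by
  by_cases h : b < 5
  · cases b with
    | zero => simp [d₂_X_zero]
    | succ b =>
      rw [d₂_X_succ _ (by omega), X_mul_X, Nat.cast_smul_eq_nsmul F]
      simp [add_comm 1 b]
  · simp [X_eq_zero (F := F) (a := a) (b := b) (by omega)]

/-- The basis of monomials of `𝒪(2; (1,1))`. -/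
noncomputable def basis (F : Type*) [CommRing F] : Module.Basis (Fin 5 × Fin 5) F (DivPow F) :=
  (Pi.basisFun F (Fin 5 × Fin 5) : Module.Basis (Fin 5 × Fin 5) F (Fin 5 × Fin 5 → F))

theorem basis_apply (c : Fin 5 × Fin 5) : basis F c = X F c.1 c.2 := by
  refine (Pi.basisFun_apply F _ c).trans (funext fun d => ?_)
  rw [Pi.single_apply, X_apply]
  simp only [Prod.ext_iff, Fin.ext_iff]

end DivPow

namespace Melikian

open DivPow WittAlg

section Basis

variable {F : Type*} [CommRing F]

/-- The five components of an element of `ℳ(1,1)`: the elements `f`, `u₁`, `u₂`, `v₁`, `v₂` of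
`𝒪(2; (1,1))` for `f + u₁ ∂₁ + u₂ ∂₂ + (v₁ ∂₁ + v₂ ∂₂)~`. -/
def coords : Melikian F ≃ₗ[F] (Fin 5 → DivPow F) where
  toFun x := ![x.fn, x.vec.1, x.vec.2, x.til.1, x.til.2]
  invFun f := (f 0, (f 1, f 2), (f 3, f 4))
  map_add' x y := by ext u : 1; fin_cases u <;> rfl
  map_smul' r x := by ext u : 1; fin_cases u <;> rfl
  left_inv _ := rfl
  right_inv f := by ext u : 1; fin_cases u <;> rfl

/-- The embeddings `f ↦ f`, `f ↦ f ∂₁`, `f ↦ f ∂₂`, `f ↦ (f ∂₁)~`, `f ↦ (f ∂₂)~` of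
`𝒪(2; (1,1))` into `ℳ(1,1)`, for `u = 0, 1, 2, 3, 4`. -/
def emb (u : Fin 5) : DivPow F →ₗ[F] Melikian F :=
  coords.symm.toLinearMap ∘ₗ LinearMap.single F (fun _ => DivPow F) u

theorem emb_fn (u : Fin 5) (f : DivPow F) : (emb u f).fn = if u = 0 then f else 0 := by
  fin_cases u <;> rfl

theorem emb_vec (u : Fin 5) (f : DivPow F) :
    (emb u f).vec = (if u = 1 then f else 0, if u = 2 then f else 0) := by
  fin_cases u <;> rfl

theorem emb_til (u : Fin 5) (f : DivPow F) :
    (emb u f).til = (if u = 3 then f else 0, if u = 4 then f else 0) := by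
  fin_cases u <;> rfl

/-- The basis element `x₁^(a) x₂^(b)` of the copy `emb u` of `𝒪(2; (1,1))`, read as `0` if `a`
or `b` exceeds `4`. -/
def e (F : Type*) [CommRing F] (u : Fin 5) (a b : ℕ) : Melikian F := emb u (X F a b)

/-- The basis of `ℳ(1,1)` made of the monomials in each of the five components. -/
noncomputable def basis (F : Type*) [CommRing F] :
    Module.Basis (Σ _ : Fin 5, Fin 5 × Fin 5) F (Melikian F) :=
  (Pi.basis fun _ => DivPow.basis F).map coords.symm

theorem basis_apply (i : Σ _ : Fin 5, Fin 5 × Fin 5) :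
    basis F i = e F i.1 i.2.1 i.2.2 := by
  rw [basis, Module.Basis.map_apply, Pi.basis_apply, DivPow.basis_apply]
  rfl

instance : Module.Free F (Melikian F) := Module.Free.of_basis (basis F)

variable {V : Type*} [AddCommGroup V] [Module F V]

theorem hom_ext {f g : Melikian F →ₗ[F] V}
    (h : ∀ u a b, a < 5 → b < 5 → f (e F u a b) = g (e F u a b)) : f = g :=
  (basis F).ext fun i => by
    rw [basis_apply]
    exact h _ _ _ i.2.1.isLt i.2.2.isLt

end Basis

section Bracket

variable {F : Type*} [CommRing F]

/-- The multiplicity of `∂₁(p) f` in the bracket of `p ∂₁` with the copy `emb u` of `f`. -/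
def k₁ : Fin 5 → ℤ := ![-2, -1, 0, 1, 2]

/-- The multiplicity of `∂₂(p) f` in the bracket of `p ∂₂` with the copy `emb u` of `f`. -/
def k₂ : Fin 5 → ℤ := ![-2, 0, -1, 2, 1]

theorem lie_emb_one {p : DivPow F} (hp : d₂ p = 0) (u : Fin 5) (f : DivPow F) :
    ⁅emb 1 p, emb u f⁆ = emb u (p * d₁ f + (k₁ u : DivPow F) * (d₁ p * f)) := by
  fin_cases u <;> apply ext_comp <;>
    simp only [lie_fn, lie_vec, lie_til, emb_fn, emb_vec, emb_til] <;>
    simp [app, div, brak, ham, k₁, hp] <;> ring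

theorem lie_emb_two {p : DivPow F} (hp : d₁ p = 0) (u : Fin 5) (f : DivPow F) :
    ⁅emb 2 p, emb u f⁆ = emb u (p * d₂ f + (k₂ u : DivPow F) * (d₂ p * f)) := by
  fin_cases u <;> apply ext_comp <;>
    simp only [lie_fn, lie_vec, lie_til, emb_fn, emb_vec, emb_til] <;>
    simp [app, div, brak, ham, k₂, hp] <;> ring

theorem lie_emb_zero_three (f g : DivPow F) : ⁅emb 0 f, emb 3 g⁆ = emb 1 (f * g) := by
  apply ext_comp <;>
    simp [lie_fn, lie_vec, lie_til, emb_fn, emb_vec, emb_til, app, div, brak, ham]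

theorem lie_emb_zero_four (f g : DivPow F) : ⁅emb 0 f, emb 4 g⁆ = emb 2 (f * g) := by
  apply ext_comp <;>
    simp [lie_fn, lie_vec, lie_til, emb_fn, emb_vec, emb_til, app, div, brak, ham]

theorem lie_emb_three_four (f g : DivPow F) : ⁅emb 3 f, emb 4 g⁆ = emb 0 (f * g) := by
  apply ext_comp <;>
    simp [lie_fn, lie_vec, lie_til, emb_fn, emb_vec, emb_til, app, div, brak, ham]

theorem lie_emb_zero_zero (f g : DivPow F) : ⁅emb 0 f, emb 0 g⁆ =
    emb 3 (2 * (g * d₂ f - f * d₂ g)) + emb 4 (2 * (f * d₁ g - g * d₁ f)) := by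
  apply ext_comp <;>
    simp [lie_fn, lie_vec, lie_til, emb_fn, emb_vec, emb_til, app, div, brak, ham, add_fn,
      add_vec, add_til]
  ring

/-- The weight of `e F u a b` with respect to `x₁ ∂₁`. -/
def w₁ (u : Fin 5) (a : ℕ) : ℤ := a + k₁ u

/-- The weight of `e F u a b` with respect to `x₂ ∂₂`. -/
def w₂ (u : Fin 5) (b : ℕ) : ℤ := b + k₂ u

theorem intCast_mul_eq_smul (n : ℤ) (f : DivPow F) : (n : DivPow F) * f = (n : F) • f := by
  rw [Int.cast_smul_eq_zsmul, zsmul_eq_mul]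

theorem lie_t₁_e (u : Fin 5) (a b : ℕ) :
    ⁅e F 1 1 0, e F u a b⁆ = (w₁ u a : F) • e F u a b := by
  rw [e, e, lie_emb_one (d₂_X_zero 1), X_mul_d₁_X, intCast_mul_eq_smul, ← zero_add 1,
    d₁_X_succ (by norm_num), X_zero_zero, one_mul, ← add_smul, map_smul, w₁]
  push_cast
  rfl

theorem lie_t₂_e (u : Fin 5) (a b : ℕ) :
    ⁅e F 2 0 1, e F u a b⁆ = (w₂ u b : F) • e F u a b := by
  rw [e, e, lie_emb_two (d₁_X_zero 1), X_mul_d₂_X, intCast_mul_eq_smul, ← zero_add 1,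
    d₂_X_succ _ (by norm_num), X_zero_zero, one_mul, ← add_smul, map_smul, w₂]
  push_cast
  rfl

theorem lie_t₁_t₂ : ⁅e F 1 1 0, e F 2 0 1⁆ = 0 := by
  rw [lie_t₁_e]
  simp [w₁, k₁]

theorem lie_d₁_emb (u : Fin 5) (f : DivPow F) : ⁅e F 1 0 0, emb u f⁆ = emb u (d₁ f) := by
  rw [e, lie_emb_one (d₂_X_zero 0), d₁_X_zero, X_zero_zero]
  simp

theorem lie_d₂_emb (u : Fin 5) (f : DivPow F) : ⁅e F 2 0 0, emb u f⁆ = emb u (d₂ f) := by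
  rw [e, lie_emb_two (d₁_X_zero 0), d₂_X_zero, X_zero_zero]
  simp

theorem lie_d₁_e_zero (u : Fin 5) (b : ℕ) : ⁅e F 1 0 0, e F u 0 b⁆ = 0 := by
  rw [e.eq_def F u, lie_d₁_emb, d₁_X_zero, map_zero]

theorem lie_d₂_e_zero (u : Fin 5) (a : ℕ) : ⁅e F 2 0 0, e F u a 0⁆ = 0 := by
  rw [e.eq_def F u, lie_d₂_emb, d₂_X_zero, map_zero]

theorem lie_d₁_e_succ (u : Fin 5) {a : ℕ} (ha : a < 4) (b : ℕ) :
    ⁅e F 1 0 0, e F u (a + 1) b⁆ = e F u a b := by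
  rw [e.eq_def F u, lie_d₁_emb, d₁_X_succ ha, e]

theorem lie_d₂_e_succ (u : Fin 5) (a : ℕ) {b : ℕ} (hb : b < 4) :
    ⁅e F 2 0 0, e F u a (b + 1)⁆ = e F u a b := by
  rw [e.eq_def F u, lie_d₂_emb, d₂_X_succ a hb, e]

theorem lie_e_three_e_four : ⁅e F 3 0 4, e F 4 4 0⁆ = e F 0 4 4 := by
  rw [e, e, lie_emb_three_four, X_mul_X, e]
  simp

theorem lie_e_top_e_three : ⁅e F 0 4 4, e F 3 0 0⁆ = e F 1 4 4 := by
  rw [e, e, lie_emb_zero_three, X_zero_zero, mul_one, e]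

theorem lie_e_top_e_four : ⁅e F 0 4 4, e F 4 0 0⁆ = e F 2 4 4 := by
  rw [e, e, lie_emb_zero_four, X_zero_zero, mul_one, e]

end Bracket

section Potential

variable {F V : Type*} [CommRing F] [AddCommGroup V] [Module F V]
  {ω : Melikian F →ₗ[F] Melikian F →ₗ[F] V}

/-- A primitive of `ω` along `∂₁` and `∂₂`: for a cocycle normalized on the torus, subtracting its
coboundary puts `∂₁` and `∂₂` into the radical. -/
noncomputable def potential (ω : Melikian F →ₗ[F] Melikian F →ₗ[F] V) : Melikian F →ₗ[F] V :=
  (basis F).constr F fun i => if i.2.1.val < 4 then ω (e F 1 0 0) (e F i.1 (i.2.1 + 1) i.2.2)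
    else ω (e F 2 0 0) (e F i.1 4 (i.2.2 + 1))

theorem potential_basis (i : Σ _ : Fin 5, Fin 5 × Fin 5) : potential ω (basis F i) =
    if i.2.1.val < 4 then ω (e F 1 0 0) (e F i.1 (i.2.1 + 1) i.2.2)
    else ω (e F 2 0 0) (e F i.1 4 (i.2.2 + 1)) :=
  (basis F).constr_basis F _ i

theorem potential_e_of_lt (u : Fin 5) {a b : ℕ} (ha : a < 4) (hb : b < 5) :
    potential ω (e F u a b) = ω (e F 1 0 0) (e F u (a + 1) b) := by
  have hbasis := potential_basis (ω := ω) ⟨u, ⟨a, by omega⟩, ⟨b, hb⟩⟩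
  rwa [basis_apply, if_pos ha] at hbasis

theorem potential_e_four (u : Fin 5) {b : ℕ} (hb : b < 5) :
    potential ω (e F u 4 b) = ω (e F 2 0 0) (e F u 4 (b + 1)) := by
  have hbasis := potential_basis (ω := ω) ⟨u, 4, ⟨b, hb⟩⟩
  rwa [basis_apply] at hbasis

end Potential

section CharFive

variable {F : Type*} [CommRing F] [CharP F 5]

theorem two_mul_four_smul_sub_self (f : DivPow F) : 2 * ((4 : F) • f - f) = f := by
  have h5 : (5 : DivPow F) = 0 := CharP.cast_eq_zero (DivPow F) 5
  rw [ofNat_smul_eq_nsmul, nsmul_eq_mul]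
  linear_combination f * h5

theorem lie_e_top_e_zero : ⁅e F 0 4 4, e F 0 0 1⁆ = e F 3 4 4 := by
  have h₁ : X F 0 1 * d₁ (X F 4 4) = 0 := by
    rw [d₁_X_succ (by norm_num), X_mul_X, X_eq_zero (by norm_num), smul_zero]
  rw [e, e, lie_emb_zero_zero, X_mul_d₂_X, h₁, d₂_X_succ 0 (by norm_num), X_zero_zero, mul_one,
    d₁_X_zero, mul_zero, sub_zero, mul_zero, map_zero, add_zero, e]
  exact congrArg (emb 3) (two_mul_four_smul_sub_self _)

theorem lie_e_zero_e_top : ⁅e F 0 1 0, e F 0 4 4⁆ = e F 4 4 4 := by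
  have h₂ : X F 1 0 * d₂ (X F 4 4) = 0 := by
    rw [d₂_X_succ 4 (by norm_num), X_mul_X, X_eq_zero (by norm_num), smul_zero]
  rw [e, e, lie_emb_zero_zero, X_mul_d₁_X, h₂, d₁_X_succ (by norm_num), X_zero_zero, mul_one,
    d₂_X_zero, mul_zero, sub_zero, mul_zero, map_zero, zero_add, e]
  exact congrArg (emb 4) (two_mul_four_smul_sub_self _)

instance : Fact (Nat.Prime 5) := ⟨Nat.prime_five⟩

theorem derivedSeries_one_eq_top : LieAlgebra.derivedSeries F (Melikian F) 1 = ⊤ := by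
  have not_dvd_weight : ∀ u a b : Fin 5,
      a.val < 4 ∨ b.val < 4 ∨ ¬ 5 ∣ w₁ u a ∨ ¬ 5 ∣ w₂ u b := by
    decide
  have mem_of_weight {t x : Melikian F} {n : ℤ} (hn : ¬ 5 ∣ n) (hx : ⁅t, x⁆ = (n : F) • x) :
      x ∈ LieAlgebra.derivedSeries F (Melikian F) 1 := by
    have hlie := lie_mem_derivedSeries_one (R := F) t x
    rw [hx] at hlie
    exact (Submodule.smul_mem_iff_of_isUnit _ ((CharP.isUnit_intCast_iff Fact.out).mpr hn)).mp hlie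
  rw [← LieSubmodule.toSubmodule_eq_top, ← top_le_iff, ← (basis F).span_eq, Submodule.span_le]
  rintro _ ⟨⟨u, a, b⟩, rfl⟩
  rw [basis_apply]
  rcases not_dvd_weight u a b with h | h | h | h
  · rw [← lie_d₁_e_succ u h]
    exact lie_mem_derivedSeries_one _ _
  · rw [← lie_d₂_e_succ u _ h]
    exact lie_mem_derivedSeries_one _ _
  · exact mem_of_weight h (lie_t₁_e u a b)
  · exact mem_of_weight h (lie_t₂_e u a b)

section Cocycle

variable {V : Type*} [AddCommGroup V] [Module F V]
  {ω : Melikian F →ₗ[F] Melikian F →ₗ[F] V}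

theorem eq_zero_of_w₁ (h : IsTrivialCocycle ω) (ht : e F 1 1 0 ∈ h.radical) {u v : Fin 5}
    {a c : ℕ} (b d : ℕ) (hw : ¬ 5 ∣ w₁ u a + w₁ v c) : ω (e F u a b) (e F v c d) = 0 :=
  h.eq_zero_of_weight (p := 5) ht (lie_t₁_e u a b) (lie_t₁_e v c d) hw

theorem eq_zero_of_w₂ (h : IsTrivialCocycle ω) (ht : e F 2 0 1 ∈ h.radical) {u v : Fin 5}
    (a c : ℕ) {b d : ℕ} (hw : ¬ 5 ∣ w₂ u b + w₂ v d) : ω (e F u a b) (e F v c d) = 0 :=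
  h.eq_zero_of_weight (p := 5) ht (lie_t₂_e u a b) (lie_t₂_e v c d) hw

theorem exists_torus_mem_radical (h : IsTrivialCocycle ω) :
    ∃ f : Melikian F →ₗ[F] V, e F 1 1 0 ∈ (h.sub_trivialCoboundary f).radical ∧
      e F 2 0 1 ∈ (h.sub_trivialCoboundary f).radical := by
  obtain ⟨f, hf, -⟩ := h.exists_mem_radical_sub_trivialCoboundary 5 derivedSeries_one_eq_top
    (basis F) (w := fun i => w₁ i.1 i.2.1) (t := e F 1 1 0) fun i => by
      rw [basis_apply, lie_t₁_e]
  obtain ⟨g, hg, hfg⟩ := (h.sub_trivialCoboundary f).exists_mem_radical_sub_trivialCoboundary 5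
    derivedSeries_one_eq_top (basis F) (w := fun i => w₂ i.1 i.2.2) (t := e F 2 0 1) fun i => by
      rw [basis_apply, lie_t₂_e]
  have hcomm : ⁅e F 2 0 1, e F 1 1 0⁆ = 0 := by rw [← lie_skew, lie_t₁_t₂, neg_zero]
  have hadd : ω - trivialCoboundary (f + g) = ω - trivialCoboundary f - trivialCoboundary g := by
    rw [trivialCoboundary_add, sub_sub]
  refine ⟨f + g, ?_, ?_⟩ <;> rw [IsTrivialCocycle.mem_radical, hadd]
  · exact hfg _ hf hcomm
  · exact hg

theorem potential_lie_t₁ (h : IsTrivialCocycle ω) (ht : e F 1 1 0 ∈ h.radical) (x : Melikian F) :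
    potential ω ⁅e F 1 1 0, x⁆ = 0 := by
  refine LinearMap.congr_fun (f := trivialCoboundary (potential ω) (e F 1 1 0)) (g := 0)
    (hom_ext fun u a b ha hb => ?_) x
  rw [trivialCoboundary_apply, lie_t₁_e, map_smul, LinearMap.zero_apply]
  by_cases hw : 5 ∣ w₁ u a
  · rw [(CharP.intCast_eq_zero_iff F 5 _).mpr hw, zero_smul]
  obtain ha | rfl : a < 4 ∨ a = 4 := by omega
  · rw [potential_e_of_lt u ha hb, eq_zero_of_w₁ h ht 0 b, smul_zero]
    have w₁_shift : w₁ 1 0 + w₁ u (a + 1) = w₁ u a := by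
      rw [w₁, w₁, w₁, show k₁ 1 = -1 from rfl]
      push_cast
      ring
    rwa [w₁_shift]
  · rw [potential_e_four u hb, eq_zero_of_w₁ h ht 0 (b + 1), smul_zero]
    simpa [w₁, k₁] using hw

theorem potential_lie_t₂ (h : IsTrivialCocycle ω) (ht : e F 2 0 1 ∈ h.radical) (x : Melikian F) :
    potential ω ⁅e F 2 0 1, x⁆ = 0 := by
  refine LinearMap.congr_fun (f := trivialCoboundary (potential ω) (e F 2 0 1)) (g := 0)
    (hom_ext fun u a b ha hb => ?_) x
  rw [trivialCoboundary_apply, lie_t₂_e, map_smul, LinearMap.zero_apply]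
  by_cases hw : 5 ∣ w₂ u b
  · rw [(CharP.intCast_eq_zero_iff F 5 _).mpr hw, zero_smul]
  obtain ha | rfl : a < 4 ∨ a = 4 := by omega
  · rw [potential_e_of_lt u ha hb, eq_zero_of_w₂ h ht 0 (a + 1), smul_zero]
    simpa [w₂, k₂] using hw
  · rw [potential_e_four u hb, eq_zero_of_w₂ h ht 0 4, smul_zero]
    have w₂_shift : w₂ 2 0 + w₂ u (b + 1) = w₂ u b := by
      rw [w₂, w₂, w₂, show k₂ 2 = -1 from rfl]
      push_cast
      ring
    rwa [w₂_shift]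

theorem torus_mem_radical_sub_potential (h : IsTrivialCocycle ω) (ht₁ : e F 1 1 0 ∈ h.radical)
    (ht₂ : e F 2 0 1 ∈ h.radical) :
    e F 1 1 0 ∈ (h.sub_trivialCoboundary (potential ω)).radical ∧
      e F 2 0 1 ∈ (h.sub_trivialCoboundary (potential ω)).radical := by
  constructor <;> refine LinearMap.ext fun x => ?_ <;>
    rw [LinearMap.sub_apply, LinearMap.sub_apply, trivialCoboundary_apply]
  · rw [h.apply_eq_zero_of_mem_radical ht₁, potential_lie_t₁ h ht₁, sub_zero, LinearMap.zero_apply]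
  · rw [h.apply_eq_zero_of_mem_radical ht₂, potential_lie_t₂ h ht₂, sub_zero, LinearMap.zero_apply]

/-- A cocycle whose radical contains the torus elements `x₁ ∂₁`, `x₂ ∂₂` and the derivations `∂₁`,
`∂₂`. -/
structure IsNormalized (ω : Melikian F →ₗ[F] Melikian F →ₗ[F] V) : Prop
    extends IsTrivialCocycle ω where
  t₁ : ω (e F 1 1 0) = 0
  t₂ : ω (e F 2 0 1) = 0
  d₁ : ω (e F 1 0 0) = 0
  d₂ : ω (e F 2 0 0) = 0

theorem isNormalized_sub_potential (h : IsTrivialCocycle ω) (ht₁ : e F 1 1 0 ∈ h.radical)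
    (ht₂ : e F 2 0 1 ∈ h.radical) : IsNormalized (ω - trivialCoboundary (potential ω)) := by
  have hη := h.sub_trivialCoboundary (potential ω)
  set η := ω - trivialCoboundary (potential ω)
  have η_apply (x y : Melikian F) : η x y = ω x y - potential ω ⁅x, y⁆ := rfl
  obtain ⟨hηt₁, hηt₂⟩ := torus_mem_radical_sub_potential h ht₁ ht₂
  have swap (x : Melikian F) : η (e F 1 0 0) ⁅e F 2 0 0, x⁆ = η (e F 2 0 0) ⁅e F 1 0 0, x⁆ :=
    hη.apply_lie_comm (lie_d₁_e_zero 2 0) x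
  have hηd₁ : η (e F 1 0 0) = 0 := hom_ext fun u a b ha hb => by
    rw [LinearMap.zero_apply]
    rcases a with - | a
    · obtain hb | rfl : b < 4 ∨ b = 4 := by omega
      · rw [← lie_d₂_e_succ u 0 hb, swap, lie_d₁_e_zero, map_zero]
      · have not_dvd_weight : ∀ u, ¬ 5 ∣ w₁ 1 0 + w₁ u 0 ∨ ¬ 5 ∣ w₂ 1 0 + w₂ u 4 := by decide
        exact (not_dvd_weight u).elim (eq_zero_of_w₁ hη hηt₁ 0 4) (eq_zero_of_w₂ hη hηt₂ 0 0)
    · rw [η_apply, lie_d₁_e_succ u (by omega), potential_e_of_lt u (by omega) hb, sub_self]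
  refine ⟨hη, hηt₁, hηt₂, hηd₁, hom_ext fun u a b ha hb => ?_⟩
  rw [LinearMap.zero_apply]
  obtain ha | rfl : a < 4 ∨ a = 4 := by omega
  · rw [← lie_d₁_e_succ u ha, ← swap, hηd₁, LinearMap.zero_apply]
  rcases b with - | b
  · have not_dvd_weight : ∀ u, ¬ 5 ∣ w₁ 2 0 + w₁ u 4 ∨ ¬ 5 ∣ w₂ 2 0 + w₂ u 0 := by decide
    exact (not_dvd_weight u).elim (eq_zero_of_w₁ hη hηt₁ 0 0) (eq_zero_of_w₂ hη hηt₂ 0 4)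
  · rw [η_apply, lie_d₂_e_succ u 4 (by omega), potential_e_four u (by omega), sub_self]

namespace IsNormalized

theorem apply_e_add_one₁ (h : IsNormalized ω) (u v : Fin 5) {a c : ℕ} (b d : ℕ) (ha : a < 4)
    (hc : c < 4) : ω (e F u a b) (e F v (c + 1) d) = -ω (e F u (a + 1) b) (e F v c d) := by
  rw [← lie_d₁_e_succ u ha, h.apply_lie_of_mem_radical h.d₁, lie_d₁_e_succ v hc]

theorem apply_e_add_one₂ (h : IsNormalized ω) (u v : Fin 5) (a c : ℕ) {b d : ℕ} (hb : b < 4)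
    (hd : d < 4) : ω (e F u a b) (e F v c (d + 1)) = -ω (e F u a (b + 1)) (e F v c d) := by
  rw [← lie_d₂_e_succ u a hb, h.apply_lie_of_mem_radical h.d₂, lie_d₂_e_succ v c hd]

theorem eq_zero_of_add_lt₁ (h : IsNormalized ω) (u v : Fin 5) {a c : ℕ} (b d : ℕ)
    (hac : a + c < 4) : ω (e F u a b) (e F v c d) = 0 := by
  induction c generalizing a with
  | zero =>
    rw [← lie_d₁_e_succ u (by omega : a < 4), h.apply_lie_of_mem_radical h.d₁, lie_d₁_e_zero,
      map_zero, neg_zero]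
  | succ c ih => rw [h.apply_e_add_one₁ u v b d (by omega) (by omega), ih (by omega), neg_zero]

theorem eq_zero_of_add_lt₂ (h : IsNormalized ω) (u v : Fin 5) (a c : ℕ) {b d : ℕ}
    (hbd : b + d < 4) : ω (e F u a b) (e F v c d) = 0 := by
  induction d generalizing b with
  | zero =>
    rw [← lie_d₂_e_succ u a (by omega : b < 4), h.apply_lie_of_mem_radical h.d₂, lie_d₂_e_zero,
      map_zero, neg_zero]
  | succ d ih => rw [h.apply_e_add_one₂ u v a c (by omega) (by omega), ih (by omega), neg_zero]

theorem apply_e_of_add_eq₁ (h : IsNormalized ω) (u v : Fin 5) {a c : ℕ} (b d : ℕ)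
    (hac : a + c = 4) :
    ω (e F u a b) (e F v c d) = (-1 : ℤ) ^ c • ω (e F u 4 b) (e F v 0 d) := by
  induction c generalizing a with
  | zero =>
    obtain rfl : a = 4 := hac
    rw [pow_zero, one_smul]
  | succ c ih =>
    rw [h.apply_e_add_one₁ u v b d (by omega) (by omega), ih (by omega), pow_succ, mul_neg_one,
      neg_smul]

theorem apply_e_of_add_eq₂ (h : IsNormalized ω) (u v : Fin 5) (a c : ℕ) {b d : ℕ}
    (hbd : b + d = 4) :
    ω (e F u a b) (e F v c d) = (-1 : ℤ) ^ d • ω (e F u a 4) (e F v c 0) := by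
  induction d generalizing b with
  | zero =>
    obtain rfl : b = 4 := hbd
    rw [pow_zero, one_smul]
  | succ d ih =>
    rw [h.apply_e_add_one₂ u v a c (by omega) (by omega), ih (by omega), pow_succ, mul_neg_one,
      neg_smul]

theorem apply_e_of_add_eq (h : IsNormalized ω) (u v : Fin 5) {a b c d : ℕ} (hac : a + c = 4)
    (hbd : b + d = 4) : ω (e F u a b) (e F v c d) =
      (-1 : ℤ) ^ c • (-1 : ℤ) ^ d • ω (e F u 4 4) (e F v 0 0) := by
  rw [h.apply_e_of_add_eq₁ u v b d hac, h.apply_e_of_add_eq₂ u v 4 0 hbd]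

theorem eq_zero_of_add_eq_of_mem_radical (h : IsNormalized ω) (u : Fin 5) {v : Fin 5}
    (hv : e F v 0 0 ∈ h.radical) {a b c d : ℕ} (hac : a + c = 4) (hbd : b + d = 4) :
    ω (e F u a b) (e F v c d) = 0 := by
  rw [h.apply_e_of_add_eq u v hac hbd, h.skew, h.apply_eq_zero_of_mem_radical hv, neg_zero,
    smul_zero, smul_zero]

theorem eq_zero_of_add_eq_zero_zero (h : IsNormalized ω) {a b c d : ℕ} (hac : a + c = 4)
    (hbd : b + d = 4) : ω (e F 0 a b) (e F 0 c d) = 0 := by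
  have apply_top : ω (e F 0 4 4) (e F 0 0 0) = 0 := by
    have apply_middle := h.apply_e_of_add_eq 0 0 (a := 2) (b := 2) (c := 2) (d := 2) rfl rfl
    rw [h.alt, even_two.neg_one_pow, one_smul, one_smul] at apply_middle
    exact apply_middle.symm
  rw [h.apply_e_of_add_eq 0 0 hac hbd, apply_top, smul_zero, smul_zero]

theorem eq_zero_of_add_eq (h : IsNormalized ω) {u v : Fin 5} {a b c d : ℕ} (hac : a + c = 4)
    (hbd : b + d = 4) (huv : (u = 0 ∧ v = 0) ∨ u = 1 ∨ u = 2 ∨ v = 1 ∨ v = 2) :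
    ω (e F u a b) (e F v c d) = 0 := by
  have hca : c + a = 4 := by rw [add_comm, hac]
  have hdb : d + b = 4 := by rw [add_comm, hbd]
  rcases huv with ⟨rfl, rfl⟩ | rfl | rfl | rfl | rfl
  · exact h.eq_zero_of_add_eq_zero_zero hac hbd
  · rw [h.skew, h.eq_zero_of_add_eq_of_mem_radical v h.d₁ hca hdb, neg_zero]
  · rw [h.skew, h.eq_zero_of_add_eq_of_mem_radical v h.d₂ hca hdb, neg_zero]
  · exact h.eq_zero_of_add_eq_of_mem_radical u h.d₁ hac hbd
  · exact h.eq_zero_of_add_eq_of_mem_radical u h.d₂ hac hbd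

end IsNormalized

/-- The basis elements `e F u a b` whose pairings under a normalized cocycle all vanish for reasons
of weight, of degree, or by `IsNormalized.eq_zero_of_add_eq`. -/
def IsLow (u : Fin 5) (a b : ℕ) : Prop :=
  ∀ v c d : Fin 5, ¬ 5 ∣ w₁ u a + w₁ v c ∨ ¬ 5 ∣ w₂ u b + w₂ v d ∨ a + c < 4 ∨ b + d < 4 ∨
    (a + c = 4 ∧ b + d = 4 ∧ ((u = 0 ∧ v = 0) ∨ u = 1 ∨ u = 2 ∨ v = 1 ∨ v = 2))

instance (u : Fin 5) (a b : ℕ) : Decidable (IsLow u a b) := by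
  unfold IsLow; infer_instance

namespace IsNormalized

theorem mem_radical_of_isLow (h : IsNormalized ω) {u : Fin 5} {a b : ℕ} (hlow : IsLow u a b) :
    e F u a b ∈ h.radical := by
  refine hom_ext fun v c d hc hd => ?_
  rw [LinearMap.zero_apply]
  rcases hlow v ⟨c, hc⟩ ⟨d, hd⟩ with hw | hw | hac | hbd | ⟨hac, hbd, huv⟩
  · exact eq_zero_of_w₁ h.toIsTrivialCocycle h.t₁ b d hw
  · exact eq_zero_of_w₂ h.toIsTrivialCocycle h.t₂ a c hw
  · exact h.eq_zero_of_add_lt₁ u v b d hac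
  · exact h.eq_zero_of_add_lt₂ u v a c hbd
  · exact h.eq_zero_of_add_eq hac hbd huv

theorem e_top_mem_radical (h : IsNormalized ω) (u : Fin 5) : e F u 4 4 ∈ h.radical := by
  have zero_top : e F 0 4 4 ∈ h.radical := lie_e_three_e_four (F := F) ▸
    h.radical.lie_mem (h.mem_radical_of_isLow (by decide)) (h.mem_radical_of_isLow (by decide))
  fin_cases u
  · exact zero_top
  · exact lie_e_top_e_three (F := F) ▸
      h.radical.lie_mem zero_top (h.mem_radical_of_isLow (by decide))
  · exact lie_e_top_e_four (F := F) ▸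
      h.radical.lie_mem zero_top (h.mem_radical_of_isLow (by decide))
  · exact lie_e_top_e_zero (F := F) ▸
      h.radical.lie_mem zero_top (h.mem_radical_of_isLow (by decide))
  · exact lie_e_zero_e_top (F := F) ▸
      h.radical.lie_mem (h.mem_radical_of_isLow (by decide)) zero_top

theorem e_mem_radical (h : IsNormalized ω) (u : Fin 5) {a b : ℕ} (ha : a ≤ 4) (hb : b ≤ 4) :
    e F u a b ∈ h.radical := by
  induction hb using Nat.decreasingInduction with
  | self =>
    induction ha using Nat.decreasingInduction with
    | self => exact h.e_top_mem_radical u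
    | of_succ a ha ih => exact lie_d₁_e_succ (F := F) u ha 4 ▸ h.radical.lie_mem h.d₁ ih
  | of_succ b hb ih => exact lie_d₂_e_succ (F := F) u a hb ▸ h.radical.lie_mem h.d₂ ih

theorem eq_zero (h : IsNormalized ω) : ω = 0 :=
  hom_ext fun u _ _ ha hb => h.e_mem_radical u (Nat.le_of_lt_succ ha) (Nat.le_of_lt_succ hb)

end IsNormalized

theorem exists_eq_trivialCoboundary (h : IsTrivialCocycle ω) :
    ∃ f : Melikian F →ₗ[F] V, ω = trivialCoboundary f := by
  obtain ⟨f, ht₁, ht₂⟩ := exists_torus_mem_radical h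
  have normalized_eq_zero := (isNormalized_sub_potential _ ht₁ ht₂).eq_zero
  refine ⟨f + potential (ω - trivialCoboundary f), ?_⟩
  rw [trivialCoboundary_add, ← sub_eq_zero, ← sub_sub, normalized_eq_zero]

end Cocycle

end CharFive

end Melikian

theorem mainTheorem8_general {F : Type*} [CommRing F] [CharP F 5] :
    (∀ (V : Type*) [AddCommGroup V] [Module F V],
      LieH2 F (Melikian F) (TrivialLieModule F (Melikian F) V) = ⊥) ∧
    (∀ (E : Type*) [LieRing E] [LieAlgebra F E] (p : E →ₗ⁅F⁆ Melikian F),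
      Function.Surjective p → p.ker ≤ LieAlgebra.center F E →
        ∃ s : Melikian F →ₗ⁅F⁆ E, ∀ x, p (s x) = x) ∧
    (∀ (L : Type*) [LieRing L] [LieAlgebra F L],
      Nonempty ((L ⧸ LieAlgebra.center F L) ≃ₗ⁅F⁆ Melikian F) →
        Nonempty (LieAlgebra.derivedSeries F L 1 ≃ₗ⁅F⁆ Melikian F) ∧
        IsCompl (LieAlgebra.derivedSeries F L 1) (LieAlgebra.center F L)) := by
  have perfect := Melikian.derivedSeries_one_eq_top (F := F)
  refine ⟨fun V _ _ => lieH2_eq_bot fun _ => Melikian.exists_eq_trivialCoboundary, ?_, ?_⟩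
  · intro E _ _ p hsurj hp
    exact exists_lieHom_section perfect (fun _ => Melikian.exists_eq_trivialCoboundary) hsurj hp
  · rintro L _ _ ⟨φ⟩
    exact derivedSeries_one_equiv_and_isCompl_center perfect
      (fun _ => Melikian.exists_eq_trivialCoboundary) φ

/-- The restricted Melikian algebra `ℳ(1,1)` over an algebraically closed field `F` of
characteristic `5` satisfies `H²(ℳ, F) = 0` for the trivial module `F`, every central extension
of it splits, and a Lie algebra `L` with `L / 𝔷(L) ≅ ℳ` satisfies `[L, L] ≅ ℳ` and
`L = [L, L] ⊕ 𝔷(L)`. -/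
theorem mainTheorem8 {F : Type*} [Field F] [IsAlgClosed F] [CharP F 5] :
    LieH2 F (Melikian F) (TrivialLieModule F (Melikian F) F) = ⊥ ∧
    (∀ (E : Type*) [LieRing E] [LieAlgebra F E] (p : E →ₗ⁅F⁆ Melikian F),
      Function.Surjective p → p.ker ≤ LieAlgebra.center F E →
        ∃ s : Melikian F →ₗ⁅F⁆ E, ∀ x, p (s x) = x) ∧
    (∀ (L : Type*) [LieRing L] [LieAlgebra F L],
      Nonempty ((L ⧸ LieAlgebra.center F L) ≃ₗ⁅F⁆ Melikian F) →
        Nonempty (LieAlgebra.derivedSeries F L 1 ≃ₗ⁅F⁆ Melikian F) ∧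
        IsCompl (LieAlgebra.derivedSeries F L 1) (LieAlgebra.center F L)) := by
  obtain ⟨hcohomology, hsplit⟩ := mainTheorem8_general (F := F)
  exact ⟨hcohomology F, hsplit⟩
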